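/- Let $X=(X,d,\mu)$ be a metric space equipped with a complete Borel measure $\mu$ (defined on the completion of the Borel $\sigma$-algebra) such that $0<\mu(B)<\infty$ for every ball $B\subset X$. Fix $x_0\in X$ and write $B_r=B(x_0,r)=\{x:d(x,x_0)<r\}$. *Definitions.* Curves are nonconstant, compact and rectifiable, parametrized by arc length $ds$. For $1\le p<\infty$, a Borel function $g:X\to[0,\infty]$ is an upper gradient of a function $f$ on $X$ if $|f(\gamma(0))-f(\gamma(l_\gamma))|\le\int_\gamma g\,ds$ for all curves $\gamma:[0,l_\gamma]\to X$; a measurable $g:X\to[0,\infty]$ is a $p$-weak upper gradient of $f$ if this holds for all curves outside a family $\Gamma$ for which there is a Borel function $\rho\ge0$ in $L^p(X)$ with $\int_\gamma\rho\,ds=\infty$ for every $\gamma\in\Gamma$. The Newtonian space $N^{1,p}(X)$ consists of the everywhere defined measurable functions $f$ with $$\|f\|_{N^{1,p}(X)}=\Bigl(\int_X|f|^p\,d\mu+\inf_g\int_X g^p\,d\mu\Bigr)^{1/p}<\infty ,$$ the infimum being over all upper gradients $g$ of $f$. Every $u\in N^{1,p}(X)$ has an a.e. unique minimal $p$-weak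 upper gradient $g_u\in L^p(X)$, i.e. $g_u\le g$ a.e. for every $p$-weak upper gradient $g\in L^p(X)$ of $u$. For $\Omega\subset X$ open and $E\subset\Omega$, the variational $p$-capacity is $$\operatorname{cap}_p(E,\Omega)=\inf_u\int_\Omega g_u^p\,d\mu\in[0,\infty],$$ the infimum being over all $u\in N^{1,p}(X)$ with $\chi_E\le u\le1$ in $\Omega$ and $u=0$ on $X\setminus\Omega$. For $1\le q<\infty$, $X$ supports a $q$-Poincaré inequality at $x_0$ if there are constants $C>0$ and $\lambda\ge1$ such that, for all $r>0$, all integrable functions $f$ on $X$ and all upper gradients $g$ of $f$, $$\frac1{\mu(B_r)}\int_{B_r}\Bigl|f-\frac1{\mu(B_r)}\int_{B_r}f\,d\mu\Bigr|\,d\mu\le Cr\Bigl(\frac1{\mu(B_{\lambda r})}\int_{B_{\lambda r}}g^q\,d\mu\Bigr)^{1/q}.$$ **Proposition.** Let $1\le q<p<\infty$ and assume that $X$ supports a $q$-Poincaré inequality at $x_0$. Let $R>0$ be such that $\mu(X\setminus B_R)>0$, which in particular holds if $X\setminus\overline{B_R}\neq\varnothing$. Then $$\lim_{\delta\to0+}\operatorname{cap}_p(B_{R-\delta},B_R)=\infty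 .$$ If in addition $\mu(\{y:d(y,x_0)=R\})=0$, then also $$\lim_{\delta\to0+}\operatorname{cap}_p(B_R,B_{R+\delta})=\infty .$$ -/

import Mathlib

open MeasureTheory Set Filter Metric
open scoped Topology ENNReal

noncomputable section

namespace MetricSobolev

/-- A nonconstant compact rectifiable curve in `X`, parametrized by arc length on `[0, length]`.
Only the values of `toFun` on `[0, length]` matter. The unit speed condition says that the
variation (length) of the curve on `[s, t]` is `t - s`; in particular it is `1`-Lipschitz there. -/
structure RectCurve (X : Type*) [MetricSpace X] where
  toFun : ℝ → X
  length : ℝ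
  length_pos : 0 < length
  unitSpeed : HasUnitSpeedOn toFun (Icc 0 length)

/-- The line integral `∫_γ g ds` of a nonnegative function. -/
def lineIntegral {X : Type*} [MetricSpace X] (γ : RectCurve X) (g : X → ℝ≥0∞) : ℝ≥0∞ :=
  ∫⁻ t in Icc 0 γ.length, g (γ.toFun t)

/-- The inequality `|f(γ(0)) - f(γ(l_γ))| ≤ ∫_γ g ds` along the curve `γ`. -/
def UpperGradientIneq {X : Type*} [MetricSpace X] (g : X → ℝ≥0∞) (f : X → ℝ)
    (γ : RectCurve X) : Prop :=
  ENNReal.ofReal |f (γ.toFun 0) - f (γ.toFun γ.length)| ≤ lineIntegral γ g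

/-- `g : X → [0, ∞]` is an upper gradient of the function `f`: it is a Borel function and the
inequality holds along all curves. -/
def IsUpperGradient {X : Type*} [MetricSpace X] [MeasurableSpace X] [BorelSpace X]
    (g : X → ℝ≥0∞) (f : X → ℝ) : Prop :=
  Measurable g ∧ ∀ γ : RectCurve X, UpperGradientIneq g f γ

/-- The curve family `Γ` has zero `p`-modulus: some nonnegative Borel `ρ ∈ L^p(X)` has infinite
integral along every curve of `Γ`. -/
def ZeroModulus {X : Type*} [MetricSpace X] [MeasurableSpace X] [BorelSpace X]
    (p : ℝ) (μ : Measure X) (Γ : Set (RectCurve X)) : Prop :=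
  ∃ ρ : X → ℝ≥0∞, Measurable ρ ∧ ∫⁻ x, ρ x ^ p ∂μ < ∞ ∧ ∀ γ ∈ Γ, lineIntegral γ ρ = ∞

/-- `g : X → [0, ∞]` is a `p`-weak upper gradient of `f`: it is measurable with respect to the
completion of `μ` and the inequality holds along `p`-almost every curve. -/
def IsWeakUpperGradient {X : Type*} [MetricSpace X] [MeasurableSpace X] [BorelSpace X]
    (p : ℝ) (μ : Measure X) (g : X → ℝ≥0∞) (f : X → ℝ) : Prop :=
  AEMeasurable g μ ∧ ZeroModulus p μ {γ | ¬ UpperGradientIneq g f γ}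

/-- `g` is a minimal `p`-weak upper gradient of `f` (it is unique up to a.e. equality): it is a
`p`-weak upper gradient in `L^p(X)` and is a.e. at most any other one. -/
def IsMinimalWeakUpperGradient {X : Type*} [MetricSpace X] [MeasurableSpace X] [BorelSpace X]
    (p : ℝ) (μ : Measure X) (g : X → ℝ≥0∞) (f : X → ℝ) : Prop :=
  IsWeakUpperGradient p μ g f ∧ ∫⁻ x, g x ^ p ∂μ < ∞ ∧
    ∀ h : X → ℝ≥0∞, IsWeakUpperGradient p μ h f → ∫⁻ x, h x ^ p ∂μ < ∞ → ∀ᵐ x ∂μ, g x ≤ h x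

/-- The Newtonian norm `(∫ |f|^p dμ + inf_g ∫ g^p dμ)^{1/p}`, the infimum being over all upper
gradients `g` of `f` (it is `∞` when there is none). -/
def newtonianNorm {X : Type*} [MetricSpace X] [MeasurableSpace X] [BorelSpace X]
    (p : ℝ) (μ : Measure X) (f : X → ℝ) : ℝ≥0∞ :=
  (∫⁻ x, ‖f x‖ₑ ^ p ∂μ +
    ⨅ (g : X → ℝ≥0∞) (_ : IsUpperGradient g f), ∫⁻ x, g x ^ p ∂μ) ^ (1 / p)

/-- `f` belongs to the Newtonian space `N^{1,p}(X)`. The functions are everywhere defined, and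
measurable with respect to the completion of `μ`. -/
def MemNewtonian {X : Type*} [MetricSpace X] [MeasurableSpace X] [BorelSpace X]
    (p : ℝ) (μ : Measure X) (f : X → ℝ) : Prop :=
  AEMeasurable f μ ∧ newtonianNorm p μ f < ∞

/-- `u` is admissible for `cap_p(E, Ω)`: `u ∈ N^{1,p}(X)`, `χ_E ≤ u ≤ 1` in `Ω` and `u = 0` on
`X ∖ Ω`. -/
def IsAdmissible {X : Type*} [MetricSpace X] [MeasurableSpace X] [BorelSpace X]
    (p : ℝ) (μ : Measure X) (E Ω : Set X) (u : X → ℝ) : Prop :=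
  MemNewtonian p μ u ∧ (∀ x ∈ Ω, E.indicator (fun _ => (1 : ℝ)) x ≤ u x ∧ u x ≤ 1) ∧
    ∀ x ∈ Ωᶜ, u x = 0

/-- The variational capacity `cap_p(E, Ω)`, for `E ⊆ Ω` with `Ω` open: the infimum of
`∫_Ω g_u^p dμ` over all admissible `u`, where `g_u` is the minimal `p`-weak upper gradient
of `u`. -/
def variationalCapacity {X : Type*} [MetricSpace X] [MeasurableSpace X] [BorelSpace X]
    (p : ℝ) (μ : Measure X) (E Ω : Set X) : ℝ≥0∞ :=
  ⨅ (u : X → ℝ) (_ : IsAdmissible p μ E Ω u)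
    (g : X → ℝ≥0∞) (_ : IsMinimalWeakUpperGradient p μ g u), ∫⁻ x in Ω, g x ^ p ∂μ

/-- `X` supports a `q`-Poincaré inequality at the point `x`. -/
def SupportsPoincareAt {X : Type*} [MetricSpace X] [MeasurableSpace X] [BorelSpace X]
    (q : ℝ) (μ : Measure X) (x : X) : Prop :=
  ∃ C lam : ℝ, 0 < C ∧ 1 ≤ lam ∧
    ∀ r : ℝ, 0 < r → ∀ f : X → ℝ, Integrable f μ → ∀ g : X → ℝ≥0∞, IsUpperGradient g f →
      ⨍⁻ y in ball x r, ‖f y - ⨍ z in ball x r, f z ∂μ‖ₑ ∂μ ≤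
        ENNReal.ofReal (C * r) * (⨍⁻ y in ball x (lam * r), g y ^ q ∂μ) ^ (1 / q)

end MetricSobolev

end

/-! An admissible function `u` is `1` on a closed set `K` inside `E` and `0` off `Ω`, so all its
energy can be placed in the gap `Ω \ K`. Fix a ball containing sets `D₁ ⊆ K` and `D₀ ⊆ Ωᶜ` of
positive measure. There `u` has mean oscillation bounded below, whatever its average
(`min_measure_le_setLIntegral_enorm_sub`). By the `q`-Poincaré inequality and Hölder, the
oscillation is at most a constant times a positive power of the energy times a positive power of `μ
(Ω \ K)`; the latter power is positive because `q < p`. Hence the energy must blow up when the gap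
shrinks to measure zero.

The Poincaré inequality concerns genuine upper gradients, while the capacity uses weak ones on `Ω`
only. `IsWeakUpperGradient.exists_isUpperGradient` bridges this: cut off to the gap, add `ε * ρ`,
and let `ε → 0`. -/

namespace MetricSobolev

/-! ### Subcurves and cutting off along a curve -/

section Curves

variable {X : Type*} [MetricSpace X]

/-- The restriction of a curve to `[s, t]`, reparametrized on `[0, t - s]`. -/
def RectCurve.subcurve (γ : RectCurve X) {s t : ℝ} (hs : 0 ≤ s) (hst : s < t)
    (ht : t ≤ γ.length) : RectCurve X where
  toFun τ := γ.toFun (s + τ)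
  length := t - s
  length_pos := sub_pos.2 hst
  unitSpeed := by
    intro x hx y hy
    have hmono : MonotoneOn (fun τ : ℝ => s + τ) (Icc 0 (t - s)) :=
      fun a _ b _ hab => by simpa using hab
    have hx' : s + x ∈ Icc 0 γ.length := ⟨by linarith [hx.1], by linarith [hx.2]⟩
    have hy' : s + y ∈ Icc 0 γ.length := ⟨by linarith [hy.1], by linarith [hy.2]⟩
    have hcomp := eVariationOn.comp_inter_Icc_eq_of_monotoneOn γ.toFun _ hmono hx hy
    have himage : (fun τ : ℝ => s + τ) '' Icc 0 (t - s) = Icc s t := by simp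
    have hinter : Icc s t ∩ Icc (s + x) (s + y) = Icc 0 γ.length ∩ Icc (s + x) (s + y) := by
      ext z
      simp only [mem_inter_iff, mem_Icc] at *
      constructor <;> rintro ⟨⟨_, _⟩, _, _⟩ <;> refine ⟨⟨?_, ?_⟩, ?_, ?_⟩ <;> linarith
    rw [himage, hinter, γ.unitSpeed hx' hy'] at hcomp
    rw [show (fun τ => γ.toFun (s + τ)) = γ.toFun ∘ fun τ => s + τ from rfl, hcomp]
    congr 2
    ring

theorem lineIntegral_subcurve (γ : RectCurve X) {s t : ℝ} (hs : 0 ≤ s) (hst : s < t)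
    (ht : t ≤ γ.length) (g : X → ℝ≥0∞) :
    lineIntegral (γ.subcurve hs hst ht) g = ∫⁻ τ in Icc s t, g (γ.toFun τ) := by
  have h := (measurePreserving_add_left volume s).setLIntegral_comp_preimage_emb
    (measurableEmbedding_addLeft s) (fun τ => g (γ.toFun τ)) (Icc s t)
  simpa [lineIntegral, RectCurve.subcurve] using h

theorem RectCurve.continuousOn (γ : RectCurve X) : ContinuousOn γ.toFun (Icc 0 γ.length) := by
  have hle : ∀ a ∈ Icc 0 γ.length, ∀ b ∈ Icc 0 γ.length, a ≤ b →
      edist (γ.toFun a) (γ.toFun b) ≤ edist a b := by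
    intro a ha b hb hab
    calc edist (γ.toFun a) (γ.toFun b) ≤ eVariationOn γ.toFun (Icc 0 γ.length ∩ Icc a b) :=
          eVariationOn.edist_le _ ⟨ha, left_mem_Icc.2 hab⟩ ⟨hb, right_mem_Icc.2 hab⟩
      _ = edist a b := by
          rw [γ.unitSpeed ha hb, edist_dist, dist_comm, Real.dist_eq,
            abs_of_nonneg (sub_nonneg.2 hab)]
          simp
  have hlip : LipschitzOnWith 1 γ.toFun (Icc 0 γ.length) := by
    intro a ha b hb
    rcases le_total a b with hab | hab
    · simpa using hle a ha b hb hab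
    · simpa [edist_comm] using hle b hb a ha hab
  exact hlip.continuousOn

/-- If `φ` is constant on a closed set `F`, then an integral bound on the increments of `φ` remains
valid when the integrand is replaced by `0` on `F`. -/
theorem ofReal_abs_sub_le_setLIntegral_indicator_compl {φ : ℝ → ℝ} {G : ℝ → ℝ≥0∞} {a b : ℝ}
    {F : Set ℝ} (hF : IsClosed F) (hφ : ∀ s ∈ F, ∀ t ∈ F, φ s = φ t)
    (h : ∀ s t, a ≤ s → s ≤ t → t ≤ b →
      ENNReal.ofReal |φ s - φ t| ≤ ∫⁻ τ in Icc s t, G τ)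
    {s t : ℝ} (hs : a ≤ s) (hst : s ≤ t) (ht : t ≤ b) :
    ENNReal.ofReal |φ s - φ t| ≤ ∫⁻ τ in Icc s t, Fᶜ.indicator G τ := by
  by_cases hne : (F ∩ Icc s t).Nonempty
  -- Let `t₁` and `t₂` be the first and last times in `F`. Since `φ t₁ = φ t₂`, only the increments
  -- before `t₁` and after `t₂` count, and there the path avoids `F`.
  · have hcpt : IsCompact (F ∩ Icc s t) := isCompact_Icc.inter_left hF
    obtain ⟨t₁, ⟨ht₁F, hst₁, -⟩, hleast⟩ := hcpt.exists_isLeast hne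
    obtain ⟨t₂, ⟨ht₂F, hst₂, ht₂t⟩, hgreatest⟩ := hcpt.exists_isGreatest hne
    have h₁₂ : t₁ ≤ t₂ := hleast ⟨ht₂F, hst₂, ht₂t⟩
    have hleft : ENNReal.ofReal |φ s - φ t₁| ≤ ∫⁻ τ in Ico s t₁, Fᶜ.indicator G τ := by
      refine (h s t₁ hs hst₁ (by linarith)).trans ?_
      rw [← setLIntegral_congr Ico_ae_eq_Icc]
      refine setLIntegral_mono' measurableSet_Ico fun τ hτ => ?_
      rw [indicator_of_mem]
      exact fun hτF => (hleast ⟨hτF, hτ.1, by linarith [hτ.2]⟩).not_gt hτ.2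
    have hright : ENNReal.ofReal |φ t₂ - φ t| ≤ ∫⁻ τ in Ioc t₂ t, Fᶜ.indicator G τ := by
      refine (h t₂ t (by linarith) ht₂t ht).trans ?_
      rw [← setLIntegral_congr Ioc_ae_eq_Icc]
      refine setLIntegral_mono' measurableSet_Ioc fun τ hτ => ?_
      rw [indicator_of_mem]
      exact fun hτF => (hgreatest ⟨hτF, by linarith [hτ.1], hτ.2⟩).not_gt hτ.1
    have hdisj : Disjoint (Ico s t₁) (Ioc t₂ t) :=
      Set.disjoint_left.2 fun τ hτ hτ' => by linarith [hτ.2, hτ'.1]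
    calc ENNReal.ofReal |φ s - φ t| ≤ ENNReal.ofReal (|φ s - φ t₁| + |φ t₂ - φ t|) := by
          refine ENNReal.ofReal_le_ofReal ?_
          rw [hφ t₂ ht₂F t₁ ht₁F]
          exact abs_sub_le _ _ _
      _ = ENNReal.ofReal |φ s - φ t₁| + ENNReal.ofReal |φ t₂ - φ t| :=
          ENNReal.ofReal_add (abs_nonneg _) (abs_nonneg _)
      _ ≤ (∫⁻ τ in Ico s t₁, Fᶜ.indicator G τ) + ∫⁻ τ in Ioc t₂ t, Fᶜ.indicator G τ :=
          add_le_add hleft hright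
      _ = ∫⁻ τ in Ico s t₁ ∪ Ioc t₂ t, Fᶜ.indicator G τ :=
          (lintegral_union measurableSet_Ioc hdisj).symm
      _ ≤ ∫⁻ τ in Icc s t, Fᶜ.indicator G τ := by
          refine lintegral_mono_set (union_subset ?_ ?_)
          · exact fun τ hτ => ⟨hτ.1, by linarith [hτ.2]⟩
          · exact fun τ hτ => ⟨by linarith [hτ.1], hτ.2⟩
  · refine (h s t hs hst ht).trans (setLIntegral_mono' measurableSet_Icc fun τ hτ => ?_)
    rw [indicator_of_mem]
    exact fun hτF => hne ⟨τ, hτF, hτ⟩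

end Curves

/-! ### From weak to genuine upper gradients; Hölder's inequality -/

section Energy

variable {X : Type*} [MetricSpace X] [MeasurableSpace X] [BorelSpace X]

/-- A `p`-weak upper gradient of a function which is constant on `K` and on `Ωᶜ` can be cut off
outside `Ω \ K`, and be corrected to an upper gradient by adding an arbitrarily small multiple of
a function in `L^p`. -/
theorem IsWeakUpperGradient.exists_isUpperGradient {p : ℝ} {μ : Measure X} {g : X → ℝ≥0∞}
    {u : X → ℝ} (hg : IsWeakUpperGradient p μ g u) {K Ω : Set X} (hK : IsClosed K)
    (hΩ : IsOpen Ω) (hu1 : ∀ x ∈ K, u x = 1) (hu0 : ∀ x ∈ Ωᶜ, u x = 0) :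
    ∃ G ρ : X → ℝ≥0∞, Measurable G ∧ Measurable ρ ∧ G =ᵐ[μ] g ∧ ∫⁻ x, ρ x ^ p ∂μ < ∞ ∧
      ∀ ε : ℝ≥0∞, ε ≠ 0 → ε ≠ ∞ →
        IsUpperGradient (fun x => (Ω \ K).indicator G x + ε * ρ x) u := by
  obtain ⟨hgm, ρ, hρ, hρp, hbad⟩ := hg
  obtain ⟨N, hN, hNm, hN0⟩ := exists_measurable_superset_of_null (ae_iff.1 hgm.ae_eq_mk)
  classical
  -- A curve may spend positive time in the null set `N`, so the Borel representative must dominate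
  -- `g` everywhere; the value `∞` on `N` ensures this.
  let G : X → ℝ≥0∞ := N.piecewise (fun _ => ∞) (hgm.mk g)
  have hGm : Measurable G := measurable_const.piecewise hNm hgm.measurable_mk
  have hmem : ∀ x, x ∉ N → g x = hgm.mk g x := fun x hx => by
    by_contra hne
    exact hx (hN hne)
  have hgG : ∀ x, g x ≤ G x := fun x => by
    by_cases hx : x ∈ N
    · simp [G, hx]
    · simp [G, hx, hmem x hx]
  have hGae : G =ᵐ[μ] g := by
    filter_upwards [measure_eq_zero_iff_ae_notMem.1 hN0] with x hx
    simp [G, hx, hmem x hx]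
  refine ⟨G, ρ, hGm, hρ, hGae, hρp, fun ε hε0 hεt => ⟨?_, fun γ => ?_⟩⟩
  · exact (hGm.indicator (hΩ.measurableSet.diff hK.measurableSet)).add (hρ.const_mul ε)
  -- If `ρ` has infinite integral along `γ`, the term `ε * ρ` suffices. Otherwise its integral along
  -- every subcurve is finite, so no subcurve is exceptional.
  by_cases hγ : lineIntegral γ ρ = ∞
  · refine le_top.trans ?_
    calc (∞ : ℝ≥0∞) = ∫⁻ t in Icc 0 γ.length, ε * ρ (γ.toFun t) := by
          rw [lintegral_const_mul' _ _ hεt, show (∫⁻ t in Icc 0 γ.length, ρ (γ.toFun t)) = ∞ from hγ,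
            ENNReal.mul_top hε0]
      _ ≤ _ := lintegral_mono fun t => le_add_self
  have hsub : ∀ s t, 0 ≤ s → s ≤ t → t ≤ γ.length →
      ENNReal.ofReal |u (γ.toFun s) - u (γ.toFun t)| ≤ ∫⁻ τ in Icc s t, G (γ.toFun τ) := by
    intro s t hs hst ht
    rcases hst.eq_or_lt with rfl | hst
    · simp
    have hgood : UpperGradientIneq g u (γ.subcurve hs hst ht) := by
      by_contra hcon
      have htop := hbad _ hcon
      rw [lineIntegral_subcurve] at htop
      refine hγ (top_le_iff.1 (htop.symm.le.trans ?_))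
      exact lintegral_mono_set (Icc_subset_Icc hs ht)
    rw [UpperGradientIneq, lineIntegral_subcurve] at hgood
    have hends : u (γ.toFun s) - u (γ.toFun t) = u ((γ.subcurve hs hst ht).toFun 0) -
        u ((γ.subcurve hs hst ht).toFun (γ.subcurve hs hst ht).length) := by
      simp [RectCurve.subcurve]
    rw [hends]
    exact hgood.trans (lintegral_mono fun τ => hgG _)
  have hclosed : ∀ S : Set X, IsClosed S → IsClosed (Icc 0 γ.length ∩ γ.toFun ⁻¹' S) :=
    fun S hS => γ.continuousOn.preimage_isClosed_of_isClosed isClosed_Icc hS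
  -- `u` takes different values on `K` and `Ωᶜ`, so the two sets are cut off in succession, not as
  -- one union.
  have hcutK := fun s t hs hst ht => ofReal_abs_sub_le_setLIntegral_indicator_compl
    (φ := fun τ => u (γ.toFun τ)) (hclosed K hK)
    (fun s hs t ht => by simp only [hu1 _ hs.2, hu1 _ ht.2]) hsub (s := s) (t := t) hs hst ht
  have hcut := ofReal_abs_sub_le_setLIntegral_indicator_compl
    (φ := fun τ => u (γ.toFun τ)) (hclosed Ωᶜ hΩ.isClosed_compl)
    (fun s hs t ht => by simp only [hu0 _ hs.2, hu0 _ ht.2]) hcutK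
    le_rfl γ.length_pos.le le_rfl
  refine hcut.trans (setLIntegral_mono' measurableSet_Icc fun τ hτ => ?_)
  refine le_trans ?_ le_self_add
  by_cases hτΩ : γ.toFun τ ∈ Ω
  · by_cases hτK : γ.toFun τ ∈ K
    · simp [hτΩ, hτK, hτ.1, hτ.2]
    · simp [hτΩ, hτK]
  · simp [hτΩ, hτ.1, hτ.2]

/-- Hölder's inequality between `L^q` and `L^p` for `q < p`. -/
theorem lintegral_rpow_le_lintegral_rpow_mul_measure_univ {α : Type*} [MeasurableSpace α]
    {ν : Measure α} {f : α → ℝ≥0∞} (hf : AEMeasurable f ν) {p q : ℝ} (hq : 0 < q) (hqp : q < p) :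
    ∫⁻ x, f x ^ q ∂ν ≤ (∫⁻ x, f x ^ p ∂ν) ^ (q / p) * ν univ ^ (1 - q / p) := by
  have hp : 0 < p := hq.trans hqp
  have hlt : 1 < p / q := (one_lt_div hq).2 hqp
  have hconj := Real.HolderConjugate.conjExponent hlt
  have h := ENNReal.lintegral_mul_le_Lp_mul_Lq ν hconj (hf.pow_const q)
    (aemeasurable_const (b := (1 : ℝ≥0∞)))
  have hexp : 1 / Real.conjExponent (p / q) = 1 - q / p := by
    rw [Real.conjExponent]
    field_simp
  simpa [← ENNReal.rpow_mul, mul_div_cancel₀ p hq.ne', hexp] using h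

end Energy

end MetricSobolev

namespace MetricSobolev

/-! ### Lower bounds for the capacity from the Poincaré inequality -/

section Capacity

/-- A function which equals `1` on `D₁` and `0` on `D₀` is at a definite `L¹`-distance from every
constant. -/
theorem min_measure_le_setLIntegral_enorm_sub {X : Type*} [MeasurableSpace X] {μ : Measure X}
    {u : X → ℝ} {B D₀ D₁ : Set X}
    (hD₀ : MeasurableSet D₀) (hD₁ : MeasurableSet D₁) (hD₀B : D₀ ⊆ B) (hD₁B : D₁ ⊆ B)
    (hu0 : ∀ x ∈ D₀, u x = 0) (hu1 : ∀ x ∈ D₁, u x = 1) (m : ℝ) :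
    min (μ D₀) (μ D₁) ≤ ∫⁻ x in B, ‖u x - m‖ₑ ∂μ := by
  have hdisj : Disjoint D₀ D₁ := Set.disjoint_left.2 fun x h0 h1 => by
    simpa [hu0 x h0] using hu1 x h1
  have hone : (1 : ℝ≥0∞) ≤ ‖(0 : ℝ) - m‖ₑ + ‖(1 : ℝ) - m‖ₑ := by
    have h := enorm_sub_le (a := (1 : ℝ) - m) (b := 0 - m)
    rw [sub_sub_sub_cancel_right, sub_zero, enorm_one] at h
    rwa [add_comm]
  calc min (μ D₀) (μ D₁)
      ≤ (‖(0 : ℝ) - m‖ₑ + ‖(1 : ℝ) - m‖ₑ) * min (μ D₀) (μ D₁) := le_mul_of_one_le_left' hone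
    _ ≤ ‖(0 : ℝ) - m‖ₑ * μ D₀ + ‖(1 : ℝ) - m‖ₑ * μ D₁ := by
        rw [add_mul]
        gcongr
        · exact min_le_left _ _
        · exact min_le_right _ _
    _ = (∫⁻ x in D₀, ‖u x - m‖ₑ ∂μ) + ∫⁻ x in D₁, ‖u x - m‖ₑ ∂μ := by
        rw [setLIntegral_congr_fun hD₀ (g := fun _ => ‖(0 : ℝ) - m‖ₑ)
            fun x hx => by simp only [hu0 x hx],
          setLIntegral_congr_fun hD₁ (g := fun _ => ‖(1 : ℝ) - m‖ₑ)
            fun x hx => by simp only [hu1 x hx]]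
        simp
    _ = ∫⁻ x in D₀ ∪ D₁, ‖u x - m‖ₑ ∂μ := (lintegral_union hD₁ hdisj).symm
    _ ≤ _ := lintegral_mono_set (union_subset hD₀B hD₁B)

theorem exists_ball_measure_inter_ne_zero {X : Type*} [MetricSpace X] [MeasurableSpace X]
    {μ : Measure X} {S : Set X} (hS : μ S ≠ 0) (x₀ : X) :
    ∃ r : ℝ, 0 < r ∧ μ (S ∩ ball x₀ r) ≠ 0 := by
  by_contra! h
  refine hS (measure_mono_null (t := ⋃ n : ℕ, S ∩ ball x₀ (n + 1)) (fun x hx => ?_)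
    (measure_iUnion_null fun n => h _ (by positivity)))
  obtain ⟨n, hn⟩ := exists_nat_gt (dist x x₀)
  exact mem_iUnion.2 ⟨n, hx, by simpa using hn.trans (lt_add_one _)⟩

variable {X : Type*} [MetricSpace X] [MeasurableSpace X] [BorelSpace X]

/-- Under a `q`-Poincaré inequality, the oscillation of a function which is `1` on `K` and `0`
outside `Ω` is controlled by the energy of its `p`-weak upper gradients on `Ω` and by the measure
of `Ω \ K`. -/
theorem SupportsPoincareAt.exists_setLIntegral_enorm_sub_average_le {μ : Measure X}
    (hμ : ∀ (x : X) (r : ℝ), 0 < r → 0 < μ (ball x r) ∧ μ (ball x r) < ∞) {x₀ : X} {p q : ℝ}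
    (hq : 1 ≤ q) (hqp : q < p) (hPI : SupportsPoincareAt q μ x₀) {r : ℝ} (hr : 0 < r) :
    ∃ c : ℝ≥0∞, c ≠ ∞ ∧ ∀ (K Ω : Set X) (u : X → ℝ) (g : X → ℝ≥0∞), IsClosed K → IsOpen Ω →
      Integrable u μ → (∀ x ∈ K, u x = 1) → (∀ x ∈ Ωᶜ, u x = 0) → IsWeakUpperGradient p μ g u →
      ∫⁻ y in ball x₀ r, ‖u y - ⨍ z in ball x₀ r, u z ∂μ‖ₑ ∂μ ≤
        c * ((∫⁻ x in Ω, g x ^ p ∂μ) ^ (q / p) * μ (Ω \ K) ^ (1 - q / p)) ^ (1 / q) := by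
  obtain ⟨C, lam, hC, hlam, hP⟩ := hPI
  have hq0 : 0 < q := by linarith
  have hp0 : 0 < p := by linarith
  obtain ⟨hB0, hBt⟩ := hμ x₀ r hr
  obtain ⟨hB0', hBt'⟩ := hμ x₀ (lam * r) (by positivity)
  set B := ball x₀ r
  set B' := ball x₀ (lam * r)
  -- `a` and `b` absorb the normalizations of the two averages; `2 ^ (q - 1)` comes from the
  -- convexity bound for `(x + y) ^ q`.
  set a : ℝ≥0∞ := μ B * ENNReal.ofReal (C * r)
  set b : ℝ≥0∞ := (μ B')⁻¹ * 2 ^ (q - 1)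
  have ha : a ≠ ∞ := ENNReal.mul_ne_top hBt.ne ENNReal.ofReal_ne_top
  have hb : b ≠ ∞ := ENNReal.mul_ne_top (ENNReal.inv_ne_top.2 hB0'.ne')
    (ENNReal.rpow_ne_top_of_nonneg (by linarith) (by simp))
  refine ⟨a * b ^ (1 / q), ENNReal.mul_ne_top ha
    (ENNReal.rpow_ne_top_of_nonneg (by positivity) hb), ?_⟩
  intro K Ω u g hK hΩ hu hu1 hu0 hg
  obtain ⟨G, ρ, hG, hρ, hGg, hρp, hup⟩ := hg.exists_isUpperGradient hK hΩ hu1 hu0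
  set A := Ω \ K with hA_def
  have hA : MeasurableSet A := hΩ.measurableSet.diff hK.measurableSet
  -- Finiteness makes the error `ε ^ q * T` vanish as `ε → 0`.
  have hT : ∫⁻ x in B', ρ x ^ q ∂μ ≠ ∞ := by
    refine ((lintegral_rpow_le_lintegral_rpow_mul_measure_univ
      (ν := μ.restrict B') hρ.aemeasurable hq0 hqp).trans_lt ?_).ne
    refine ENNReal.mul_lt_top (ENNReal.rpow_lt_top_of_nonneg (by positivity)
      ((setLIntegral_le_lintegral _ _).trans_lt hρp).ne) ?_
    refine ENNReal.rpow_lt_top_of_nonneg (sub_nonneg.2 ((div_le_one hp0).2 hqp.le)) ?_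
    rw [Measure.restrict_apply_univ]
    exact hBt'.ne
  set T := ∫⁻ x in B', ρ x ^ q ∂μ
  set J := (∫⁻ x in Ω, g x ^ p ∂μ) ^ (q / p) * μ A ^ (1 - q / p)
  have hJ : ∫⁻ x in B', (A.indicator G x) ^ q ∂μ ≤ J := by
    calc ∫⁻ x in B', (A.indicator G x) ^ q ∂μ ≤ ∫⁻ x, (A.indicator G x) ^ q ∂μ :=
          setLIntegral_le_lintegral _ _
      _ = ∫⁻ x, A.indicator (fun x => G x ^ q) x ∂μ := by
          refine lintegral_congr fun x => ?_
          by_cases hx : x ∈ A <;> simp [hx, hq0]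
      _ = ∫⁻ x in A, G x ^ q ∂μ := lintegral_indicator hA _
      _ ≤ (∫⁻ x in A, G x ^ p ∂μ) ^ (q / p) * μ A ^ (1 - q / p) := by
          simpa using lintegral_rpow_le_lintegral_rpow_mul_measure_univ
            (ν := μ.restrict A) hG.aemeasurable hq0 hqp
      _ ≤ J := by
          have hint : ∫⁻ x in A, G x ^ p ∂μ ≤ ∫⁻ x in Ω, g x ^ p ∂μ := by
            rw [lintegral_congr_ae (g := fun x => g x ^ p)
              ((ae_restrict_of_ae hGg).mono fun x hx => by simp only [hx])]
            exact lintegral_mono_set sdiff_subset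
          exact mul_le_mul' (ENNReal.rpow_le_rpow hint (by positivity)) le_rfl
  have hε : ∀ ε : ℝ≥0∞, ε ≠ 0 → ε ≠ ∞ →
      ∫⁻ y in B, ‖u y - ⨍ z in B, u z ∂μ‖ₑ ∂μ ≤ a * (b * (J + ε ^ q * T)) ^ (1 / q) := by
    intro ε hε0 hεt
    have h := hP r hr u hu _ (hup ε hε0 hεt)
    have hpow : ∫⁻ y in B', (A.indicator G y + ε * ρ y) ^ q ∂μ ≤
        2 ^ (q - 1) * (J + ε ^ q * T) := by
      calc ∫⁻ y in B', (A.indicator G y + ε * ρ y) ^ q ∂μ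
          ≤ ∫⁻ y in B', 2 ^ (q - 1) * ((A.indicator G y) ^ q + ε ^ q * ρ y ^ q) ∂μ := by
            refine lintegral_mono fun y => ?_
            rw [← ENNReal.mul_rpow_of_nonneg _ _ hq0.le]
            exact ENNReal.rpow_add_le_mul_rpow_add_rpow _ _ hq
        _ = 2 ^ (q - 1) * ((∫⁻ y in B', (A.indicator G y) ^ q ∂μ) + ε ^ q * T) := by
            rw [lintegral_const_mul _ (by fun_prop (disch := assumption)),
              lintegral_add_right _ (by fun_prop), lintegral_const_mul _ (by fun_prop)]
        _ ≤ _ := by gcongr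
    rw [setLAverage_eq, setLAverage_eq] at h
    have h' : ∫⁻ y in B, ‖u y - ⨍ z in B, u z ∂μ‖ₑ ∂μ ≤ μ B * (ENNReal.ofReal (C * r) *
        ((∫⁻ y in B', (A.indicator G y + ε * ρ y) ^ q ∂μ) / μ B') ^ (1 / q)) := by
      rw [mul_comm]
      exact (ENNReal.div_le_iff hB0.ne' hBt.ne).1 h
    refine h'.trans ?_
    rw [← mul_assoc]
    gcongr
    rw [ENNReal.div_eq_inv_mul]
    calc (μ B')⁻¹ * ∫⁻ y in B', (A.indicator G y + ε * ρ y) ^ q ∂μ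
        ≤ (μ B')⁻¹ * (2 ^ (q - 1) * (J + ε ^ q * T)) := by gcongr
      _ = b * (J + ε ^ q * T) := by rw [← mul_assoc]
  have hlim : Tendsto (fun ε : ℝ≥0∞ => a * (b * (J + ε ^ q * T)) ^ (1 / q)) (𝓝[>] 0)
      (𝓝 (a * (b * (J + 0 ^ q * T)) ^ (1 / q))) := by
    refine Tendsto.mono_left ?_ nhdsWithin_le_nhds
    refine ENNReal.Tendsto.const_mul ?_ (Or.inr ha)
    refine (ENNReal.continuous_rpow_const.tendsto _).comp ?_
    refine ENNReal.Tendsto.const_mul (tendsto_const_nhds.add ?_) (Or.inr hb)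
    exact ENNReal.Tendsto.mul_const (ENNReal.continuous_rpow_const.tendsto _) (Or.inr hT)
  have hfin : ∫⁻ y in B, ‖u y - ⨍ z in B, u z ∂μ‖ₑ ∂μ ≤
      a * (b * (J + 0 ^ q * T)) ^ (1 / q) := by
    refine ge_of_tendsto hlim ?_
    have hlt : ∀ᶠ ε : ℝ≥0∞ in 𝓝[>] 0, ε < 1 :=
      mem_nhdsWithin_of_mem_nhds (Iio_mem_nhds zero_lt_one)
    filter_upwards [hlt, self_mem_nhdsWithin] with ε h1 h0
    exact hε ε (ne_of_gt h0) (h1.trans ENNReal.one_lt_top).ne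
  rwa [ENNReal.zero_rpow_of_pos hq0, zero_mul, add_zero,
    ENNReal.mul_rpow_of_nonneg _ _ (by positivity : 0 ≤ 1 / q), ← mul_assoc] at hfin

theorem IsAdmissible.integrable {p : ℝ} {μ : Measure X} {E Ω : Set X} {u : X → ℝ}
    (hu : IsAdmissible p μ E Ω u) (hΩ : MeasurableSet Ω) (hΩμ : μ Ω ≠ ∞) : Integrable u μ := by
  obtain ⟨⟨hum, -⟩, hin, hout⟩ := hu
  refine Integrable.mono' ((integrable_indicator_iff hΩ).2
    (integrableOn_const (C := (1 : ℝ)) hΩμ)) hum.aestronglyMeasurable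
    (Eventually.of_forall fun x => ?_)
  by_cases hx : x ∈ Ω
  · have h0 : 0 ≤ u x := le_trans (indicator_nonneg (fun _ _ => zero_le_one) x) (hin x hx).1
    simpa [hx, abs_of_nonneg h0] using (hin x hx).2
  · simp [hx, hout x hx]

/-- The capacity blows up along condensers `(E i, Ω i)` whose gap `Ω i \ K i`, `K i ⊆ E i` closed,
has measure tending to zero, as long as `K i` and the complement of `Ω i` do not degenerate. -/
theorem SupportsPoincareAt.tendsto_variationalCapacity {ι : Type*} {l : Filter ι} {μ : Measure X}
    (hμ : ∀ (x : X) (r : ℝ), 0 < r → 0 < μ (ball x r) ∧ μ (ball x r) < ∞) {x₀ : X} {p q : ℝ}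
    (hq : 1 ≤ q) (hqp : q < p) (hPI : SupportsPoincareAt q μ x₀) {r : ℝ} (hr : 0 < r)
    {E K Ω : ι → Set X} {D₀ D₁ : Set X} (hD₀ : MeasurableSet D₀) (hD₁ : MeasurableSet D₁)
    (hD₀μ : μ D₀ ≠ 0) (hD₁μ : μ D₁ ≠ 0) (hD₀B : D₀ ⊆ ball x₀ r) (hD₁B : D₁ ⊆ ball x₀ r)
    (hK : ∀ i, IsClosed (K i)) (hΩ : ∀ i, IsOpen (Ω i)) (hΩμ : ∀ i, μ (Ω i) ≠ ∞)
    (hKE : ∀ᶠ i in l, K i ⊆ E i) (hEΩ : ∀ᶠ i in l, E i ⊆ Ω i)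
    (hD₀Ω : ∀ᶠ i in l, D₀ ⊆ (Ω i)ᶜ) (hD₁K : ∀ᶠ i in l, D₁ ⊆ K i)
    (hgap : Tendsto (fun i => μ (Ω i \ K i)) l (𝓝 0)) :
    Tendsto (fun i => variationalCapacity p μ (E i) (Ω i)) l (𝓝 ∞) := by
  obtain ⟨c, hc, hbound⟩ := hPI.exists_setLIntegral_enorm_sub_average_le hμ hq hqp hr
  have hq0 : 0 < q := by linarith
  have hp0 : 0 < p := by linarith
  have hθ : 0 < 1 - q / p := sub_pos.2 ((div_lt_one hp0).2 hqp)
  rw [ENNReal.tendsto_nhds_top_iff_nnreal]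
  intro N
  set M : ℝ≥0∞ := (N : ℝ≥0∞) + 1
  have hM : M ≠ ∞ := by simp [M]
  have hlim : Tendsto (fun i => c * (M ^ (q / p) * μ (Ω i \ K i) ^ (1 - q / p)) ^ (1 / q)) l
      (𝓝 (c * (M ^ (q / p) * 0 ^ (1 - q / p)) ^ (1 / q))) := by
    refine ENNReal.Tendsto.const_mul ?_ (Or.inr hc)
    refine (ENNReal.continuous_rpow_const.tendsto _).comp ?_
    refine ENNReal.Tendsto.const_mul ?_
      (Or.inr (ENNReal.rpow_ne_top_of_nonneg (by positivity) hM))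
    exact (ENNReal.continuous_rpow_const.tendsto _).comp hgap
  rw [ENNReal.zero_rpow_of_pos hθ, mul_zero, ENNReal.zero_rpow_of_pos (by positivity),
    mul_zero] at hlim
  have hpos : 0 < min (μ D₀) (μ D₁) := lt_min hD₀μ.pos hD₁μ.pos
  filter_upwards [hKE, hEΩ, hD₀Ω, hD₁K, hlim.eventually (Iio_mem_nhds hpos)]
    with i hKE hEΩ hD₀Ω hD₁K hsmall
  refine (ENNReal.lt_add_right ENNReal.coe_ne_top one_ne_zero).trans_le (b := M) ?_
  refine le_iInf₂ fun u hu => le_iInf₂ fun g hg => ?_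
  -- Energy below `M` would push the Poincaré upper bound below the fixed lower bound `min (μ D₀) (μ
  -- D₁)`.
  by_contra! hlt
  have hu1 : ∀ x ∈ K i, u x = 1 := fun x hx => by
    have h := hu.2.1 x (hEΩ (hKE hx))
    rw [indicator_of_mem (hKE hx)] at h
    exact le_antisymm h.2 h.1
  have hupper := hbound (K i) (Ω i) u g (hK i) (hΩ i)
    (hu.integrable (hΩ i).measurableSet (hΩμ i)) hu1 hu.2.2 hg.1
  have hlower := min_measure_le_setLIntegral_enorm_sub (μ := μ) hD₀ hD₁ hD₀B hD₁B
    (fun x hx => hu.2.2 x (hD₀Ω hx)) (fun x hx => hu1 x (hD₁K hx))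
    (⨍ z in ball x₀ r, u z ∂μ)
  refine (hsmall.trans_le (hlower.trans (hupper.trans ?_))).false
  gcongr

end Capacity

end MetricSobolev

/-! ### The two families of concentric balls -/

theorem mainTheorem9 {X : Type*} [MetricSpace X] [MeasurableSpace X] [BorelSpace X]
    (μ : Measure X)
    (hμ : ∀ (x : X) (r : ℝ), 0 < r → 0 < μ (ball x r) ∧ μ (ball x r) < ∞)
    (x₀ : X) (p q : ℝ) (hq : 1 ≤ q) (hqp : q < p)
    (hPI : MetricSobolev.SupportsPoincareAt q μ x₀)
    (R : ℝ) (hR : 0 < R) :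
    (((closure (ball x₀ R))ᶜ).Nonempty → 0 < μ (ball x₀ R)ᶜ) ∧
    (0 < μ (ball x₀ R)ᶜ →
      Tendsto (fun δ : ℝ => MetricSobolev.variationalCapacity p μ (ball x₀ (R - δ)) (ball x₀ R))
        (𝓝[>] 0) (𝓝 ∞) ∧
      (μ {y | dist y x₀ = R} = 0 →
        Tendsto (fun δ : ℝ => MetricSobolev.variationalCapacity p μ (ball x₀ R) (ball x₀ (R + δ)))
          (𝓝[>] 0) (𝓝 ∞))) := by
  have hfin : ∀ s : ℝ, μ (ball x₀ s) ≠ ∞ := fun s => by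
    rcases le_or_gt s 0 with hs | hs
    · simp [ball_eq_empty.2 hs]
    · exact (hμ x₀ s hs).2.ne
  have hD₁μ : μ (ball x₀ (R / 2)) ≠ 0 := (hμ x₀ (R / 2) (by positivity)).1.ne'
  -- This gives `R / 2 < R - 2 * δ`, so the fixed set `D₁ = ball x₀ (R / 2)` lies in `K δ`.
  have hsmall : ∀ᶠ δ : ℝ in 𝓝[>] 0, δ < R / 4 :=
    mem_nhdsWithin_of_mem_nhds (Iio_mem_nhds (by positivity))
  have hshrink : ∀ ⦃s t : ℝ⦄, s ≤ t → closedBall x₀ (R - t) ⊆ closedBall x₀ (R - s) :=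
    fun s t hst => closedBall_subset_closedBall (by linarith)
  have hinter : ∀ x, (∀ δ > (0 : ℝ), R - 2 * δ < dist x x₀) → R ≤ dist x x₀ := fun x hx => by
    refine le_of_forall_pos_lt_add fun ε hε => ?_
    have := hx (ε / 2) (by positivity)
    linarith
  refine ⟨fun ⟨y, hy⟩ => ?_, fun hpos => ⟨?_, fun hsphere => ?_⟩⟩
  · obtain ⟨ε, hε, hball⟩ := Metric.isOpen_iff.1 isClosed_closure.isOpen_compl y hy
    exact (hμ y ε hε).1.trans_le
      (measure_mono (hball.trans (compl_subset_compl.2 subset_closure)))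
  · obtain ⟨r, hr, hrμ⟩ := MetricSobolev.exists_ball_measure_inter_ne_zero hpos.ne' x₀
    have hRr : R ≤ r := by
      by_contra! h
      refine hrμ (measure_mono_null (fun x hx => ?_) measure_empty)
      exact hx.1 (ball_subset_ball h.le hx.2)
    refine hPI.tendsto_variationalCapacity hμ hq hqp hr
      -- The factor `2` puts a closed ball strictly inside the open ball of radius `R - δ`.
      (K := fun δ => closedBall x₀ (R - 2 * δ))
      (measurableSet_ball.compl.inter measurableSet_ball) measurableSet_ball hrμ hD₁μ
      inter_subset_right (ball_subset_ball (by linarith)) (fun _ => isClosed_closedBall)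
      (fun _ => isOpen_ball) (fun _ => hfin _) ?_ ?_ ?_ ?_ ?_
    · filter_upwards [self_mem_nhdsWithin] with δ (hδ : 0 < δ)
      exact closedBall_subset_ball (by linarith)
    · filter_upwards [self_mem_nhdsWithin] with δ (hδ : 0 < δ)
      exact ball_subset_ball (by linarith)
    · exact Eventually.of_forall fun _ => inter_subset_left
    · filter_upwards [hsmall] with δ hδ
      exact ball_subset_closedBall.trans (closedBall_subset_closedBall (by linarith))
    · have h := tendsto_measure_biInter_gt (μ := μ) (a := (0 : ℝ))
        (s := fun δ => ball x₀ R \ closedBall x₀ (R - 2 * δ))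
        (fun _ _ => (measurableSet_ball.diff measurableSet_closedBall).nullMeasurableSet)
        (fun s t _ hst => sdiff_subset_sdiff_right (hshrink (by linarith)))
        ⟨1, one_pos, measure_ne_top_of_subset sdiff_subset (hfin R)⟩
      have hempty : (⋂ δ > (0 : ℝ), ball x₀ R \ closedBall x₀ (R - 2 * δ)) = ∅ := by
        refine eq_empty_of_forall_notMem fun x hx => ?_
        simp only [mem_iInter, Set.mem_sdiff, mem_ball, mem_closedBall, not_le] at hx
        exact (hx 1 one_pos).1.not_ge (hinter x fun δ hδ => (hx δ hδ).2)
      rwa [hempty, measure_empty] at h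
  · have hout : μ (closedBall x₀ R)ᶜ ≠ 0 := fun h0 => hpos.ne' <|
      measure_mono_null (t := (closedBall x₀ R)ᶜ ∪ {y | dist y x₀ = R})
        (fun x hx => by
          simp only [mem_compl_iff, mem_ball, not_lt] at hx
          rcases hx.eq_or_lt with h | h
          · exact Or.inr h.symm
          · exact Or.inl (by simpa using h))
        (measure_union_null h0 hsphere)
    -- Here `Ω` varies with `δ`, so `D₀` is taken outside one larger ball, which contains `Ω` for
    -- all `δ < η`.
    obtain ⟨η, hη, hημ⟩ : ∃ η : ℝ, 0 < η ∧ μ (ball x₀ (R + η))ᶜ ≠ 0 := by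
      by_contra! h
      refine hout (measure_mono_null (t := ⋃ n : ℕ, (ball x₀ (R + 1 / (n + 1)))ᶜ) (fun x hx => ?_)
        (measure_iUnion_null fun n => h _ Nat.one_div_pos_of_nat))
      simp only [mem_compl_iff, mem_closedBall, not_le] at hx
      obtain ⟨n, hn⟩ := exists_nat_one_div_lt (sub_pos.2 hx)
      refine mem_iUnion.2 ⟨n, ?_⟩
      simp only [mem_compl_iff, mem_ball, not_lt]
      linarith
    obtain ⟨r, hr, hrμ⟩ := MetricSobolev.exists_ball_measure_inter_ne_zero hημ x₀
    have hRr : R + η ≤ r := by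
      by_contra! h
      refine hrμ (measure_mono_null (fun x hx => ?_) measure_empty)
      exact hx.1 (ball_subset_ball h.le hx.2)
    refine hPI.tendsto_variationalCapacity hμ hq hqp hr
      (K := fun δ => closedBall x₀ (R - 2 * δ))
      (measurableSet_ball.compl.inter measurableSet_ball) measurableSet_ball hrμ hD₁μ
      inter_subset_right (ball_subset_ball (by linarith)) (fun _ => isClosed_closedBall)
      (fun _ => isOpen_ball) (fun _ => hfin _) ?_ ?_ ?_ ?_ ?_
    · filter_upwards [self_mem_nhdsWithin] with δ (hδ : 0 < δ)
      exact closedBall_subset_ball (by linarith)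
    · filter_upwards [self_mem_nhdsWithin] with δ (hδ : 0 < δ)
      exact ball_subset_ball (by linarith)
    · have hη' : ∀ᶠ δ : ℝ in 𝓝[>] 0, δ < η := mem_nhdsWithin_of_mem_nhds (Iio_mem_nhds hη)
      filter_upwards [hη'] with δ hδ
      exact inter_subset_left.trans (compl_subset_compl.2 (ball_subset_ball (by linarith)))
    · filter_upwards [hsmall] with δ hδ
      exact ball_subset_closedBall.trans (closedBall_subset_closedBall (by linarith))
    · have h := tendsto_measure_biInter_gt (μ := μ) (a := (0 : ℝ))
        (s := fun δ => ball x₀ (R + δ) \ closedBall x₀ (R - 2 * δ))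
        (fun _ _ => (measurableSet_ball.diff measurableSet_closedBall).nullMeasurableSet)
        (fun s t _ hst => sdiff_subset_sdiff (ball_subset_ball (by linarith))
          (hshrink (by linarith)))
        ⟨1, one_pos, measure_ne_top_of_subset sdiff_subset (hfin (R + 1))⟩
      -- The gaps now shrink to the sphere instead of the empty set, so its nullity is essential to
      -- this argument.
      have hzero : μ (⋂ δ > (0 : ℝ), ball x₀ (R + δ) \ closedBall x₀ (R - 2 * δ)) = 0 := by
        refine measure_mono_null (fun x hx => ?_) hsphere
        simp only [mem_iInter, Set.mem_sdiff, mem_ball, mem_closedBall, not_le] at hx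
        exact le_antisymm (le_of_forall_pos_le_add fun ε hε => (hx ε hε).1.le)
          (hinter x fun δ hδ => (hx δ hδ).2)
      rwa [hzero] at h
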